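/- Let $\Bbbk$ be a field, $S=\Bbbk[x_1,\dots,x_n]$ with the standard grading and $\mathfrak m=(x_1,\dots,x_n)$, and let $I=(u_1,\dots,u_r)\subseteq S$ be the ideal generated by monomials $u_1,\dots,u_r$ of positive degree ($n,r\ge 0$). For $\sigma\subseteq[r]=\{1,\dots,r\}$ put $m_\sigma=\operatorname{lcm}(u_i\mid i\in\sigma)$, with $m_\emptyset=1$. Call $\sigma\subseteq[r]$ critical if $$m_\sigma\neq m_{\sigma\setminus\{v\}}\ \ \forall\, v\in\sigma\qquad\text{and}\qquad m_\sigma\neq m_{\sigma\cup\{v\}}\ \ \forall\, v\in[r]\setminus\sigma .$$ (The empty set is critical.) Put $$p(S/I)=\max\{|\sigma| : \sigma\text{ critical}\},\qquad r(S/I)=\max\{\deg(m_\sigma)-|\sigma| : \sigma\text{ critical}\}.$$ Let $\beta_{i,j}(S/I)$ be the graded Betti numbers of $S/I$, that is, the number of summands $S(-j)$ in homological degree $i$ of the minimal graded free resolution of $S/I$ over $S$; let $\operatorname{reg}(S/I)=\sup\{j-i : \beta_{i,j}(S/I)\neq 0\}$, and let $\operatorname{depth}(S/I)$ be the supremum of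 the lengths of $S/I$-regular sequences in $\mathfrak m$. If $\sigma$ is critical, then $\beta_{|\sigma|,\deg(m_\sigma)}(S/I)\neq 0$. In particular, $$\operatorname{depth}(S/I)\le n-p(S/I)\qquad\text{and}\qquad \operatorname{reg}(S/I)\ge r(S/I).$$ -/

import Mathlib

namespace MonomialBetti

noncomputable section

open MvPolynomial

/-- The ideal of `k[x_1, …, x_n]` generated by the monomials `x^{u 1}, …, x^{u r}`; a monomial is
given by its exponent vector. -/
def monomialIdeal (k : Type*) [Field k] {n r : ℕ} (u : Fin r → (Fin n →₀ ℕ)) :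
    Ideal (MvPolynomial (Fin n) k) :=
  Ideal.span (Set.range fun i => monomial (u i) (1 : k))

/-- The exponent vector of `m_σ = lcm (x^{u i} | i ∈ σ)`, that is, the componentwise maximum of the
exponent vectors `u i` with `i ∈ σ` (and `0`, the exponent vector of `1`, if `σ = ∅`). -/
def lcmExp {n r : ℕ} (u : Fin r → (Fin n →₀ ℕ)) (σ : Finset (Fin r)) : Fin n →₀ ℕ :=
  σ.sup u

/-- `σ` is critical: `m_σ ≠ m_{σ ∖ {v}}` for `v ∈ σ` and `m_σ ≠ m_{σ ∪ {v}}` for `v ∉ σ`. -/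
def IsCritical {n r : ℕ} (u : Fin r → (Fin n →₀ ℕ)) (σ : Finset (Fin r)) : Prop :=
  (∀ v ∈ σ, lcmExp u σ ≠ lcmExp u (σ.erase v)) ∧
    ∀ v ∉ σ, lcmExp u σ ≠ lcmExp u (insert v σ)

/-- `p = max {|σ| : σ critical}`; see `isGreatest_pInvariant`. -/
def pInvariant {n r : ℕ} (u : Fin r → (Fin n →₀ ℕ)) : ℕ :=
  sSup {a : ℕ | ∃ σ, IsCritical u σ ∧ a = σ.card}

/-- `r = max {deg (m_σ) - |σ| : σ critical}`; see `isGreatest_rInvariant`. -/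
def rInvariant {n r : ℕ} (u : Fin r → (Fin n →₀ ℕ)) : ℤ :=
  sSup {a : ℤ | ∃ σ, IsCritical u σ ∧ a = ((lcmExp u σ).degree : ℤ) - (σ.card : ℤ)}

theorem isCritical_empty {n r : ℕ} (u : Fin r → (Fin n →₀ ℕ)) (hu : ∀ i, u i ≠ 0) :
    IsCritical u ∅ := by
  refine ⟨by simp, fun v _ h => hu v ?_⟩
  simpa [lcmExp, bot_eq_zero] using h.symm

theorem isGreatest_pInvariant {n r : ℕ} (u : Fin r → (Fin n →₀ ℕ)) (hu : ∀ i, u i ≠ 0) :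
    IsGreatest {a : ℕ | ∃ σ, IsCritical u σ ∧ a = σ.card} (pInvariant u) := by
  have hfin : {a : ℕ | ∃ σ, IsCritical u σ ∧ a = σ.card}.Finite :=
    (Set.finite_range fun σ : Finset (Fin r) => σ.card).subset
      (by rintro _ ⟨σ, _, rfl⟩; exact ⟨σ, rfl⟩)
  exact ⟨Nat.sSup_mem ⟨_, ∅, isCritical_empty u hu, rfl⟩ hfin.bddAbove,
    fun a ha => le_csSup hfin.bddAbove ha⟩

theorem isGreatest_rInvariant {n r : ℕ} (u : Fin r → (Fin n →₀ ℕ)) (hu : ∀ i, u i ≠ 0) :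
    IsGreatest {a : ℤ | ∃ σ, IsCritical u σ ∧ a = ((lcmExp u σ).degree : ℤ) - (σ.card : ℤ)}
      (rInvariant u) := by
  have hfin : {a : ℤ | ∃ σ, IsCritical u σ ∧
      a = ((lcmExp u σ).degree : ℤ) - (σ.card : ℤ)}.Finite :=
    (Set.finite_range fun σ : Finset (Fin r) =>
      ((lcmExp u σ).degree : ℤ) - (σ.card : ℤ)).subset
      (by rintro _ ⟨σ, _, rfl⟩; exact ⟨σ, rfl⟩)
  exact ⟨Int.csSup_mem ⟨_, ∅, isCritical_empty u hu, rfl⟩ hfin.bddAbove,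
    fun a ha => le_csSup hfin.bddAbove ha⟩

/-- A graded free resolution `⋯ → F_2 → F_1 → F_0 → S/I → 0` of the graded `S`-module `S/I` by
finitely generated graded free modules, where `S = k[x_1, …, x_n]` has the standard grading.
Here `F_i = ⊕_b S(-deg i b)` is the free module `Fin (rank i) → S` whose standard basis vector
number `b` has degree `deg i b`, and all maps are homogeneous of degree `0`. -/
structure GradedFreeResolution {k : Type*} [Field k] {n : ℕ}
    (I : Ideal (MvPolynomial (Fin n) k)) where
  /-- The rank of `F_i`. -/
  rank : ℕ → ℕ
  /-- The degrees of the basis vectors of `F_i`. -/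
  deg : ∀ i, Fin (rank i) → ℕ
  /-- The differential `F_{i+1} → F_i`. -/
  diff : ∀ i, (Fin (rank (i + 1)) → MvPolynomial (Fin n) k) →ₗ[MvPolynomial (Fin n) k]
    (Fin (rank i) → MvPolynomial (Fin n) k)
  /-- The augmentation `F_0 → S/I`. -/
  aug : (Fin (rank 0) → MvPolynomial (Fin n) k) →ₗ[MvPolynomial (Fin n) k]
    (MvPolynomial (Fin n) k ⧸ I)
  /-- The entry of the differential from `S(-deg (i+1) b)` to `S(-deg i c)` is zero or homogeneous
  of degree `deg (i+1) b - deg i c`. -/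
  diff_homogeneous : ∀ i b c, diff i (Pi.single b 1) c = 0 ∨
    ∃ e : ℕ, (diff i (Pi.single b 1) c).IsHomogeneous e ∧ deg i c + e = deg (i + 1) b
  /-- A basis vector of degree `d` is mapped to the class of a homogeneous polynomial of
  degree `d`. -/
  aug_homogeneous : ∀ b, ∃ f : MvPolynomial (Fin n) k, f.IsHomogeneous (deg 0 b) ∧
    aug (Pi.single b 1) = Ideal.Quotient.mk I f
  exact_succ : ∀ i, Function.Exact (diff (i + 1)) (diff i)
  exact_zero : Function.Exact (diff 0) aug
  aug_surjective : Function.Surjective aug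

/-- The resolution is minimal: the image of each differential lies in `𝔪 F_i`, where
`𝔪 = (x_1, …, x_n)`. -/
def GradedFreeResolution.IsMinimal {k : Type*} [Field k] {n : ℕ}
    {I : Ideal (MvPolynomial (Fin n) k)} (F : GradedFreeResolution I) : Prop :=
  ∀ i x c, F.diff i x c ∈ idealOfVars (Fin n) k

/-- The number of summands `S(-j)` of `F_i`. -/
def GradedFreeResolution.count {k : Type*} [Field k] {n : ℕ}
    {I : Ideal (MvPolynomial (Fin n) k)} (F : GradedFreeResolution I) (i j : ℕ) : ℕ :=
  (Finset.univ.filter fun b : Fin (F.rank i) => F.deg i b = j).card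

open Classical in
/-- The graded Betti number `β_{i,j}(S/I)`: the number of summands `S(-j)` in homological degree `i`
of the minimal graded free resolution of `S/I`. Every homogeneous ideal `I` has such a resolution,
it is unique up to isomorphism, and one and the same is used for all `i` and `j`. -/
def gradedBetti {k : Type*} [Field k] {n : ℕ} (I : Ideal (MvPolynomial (Fin n) k))
    (i j : ℕ) : ℕ :=
  if h : ∃ F : GradedFreeResolution I, F.IsMinimal then (Classical.choose h).count i j else 0

/-- The Castelnuovo-Mumford regularity `reg (S/I) = sup {j - i : β_{i,j}(S/I) ≠ 0}`, in the integers
with `-∞` and `∞` added. -/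
def regularity {k : Type*} [Field k] {n : ℕ} (I : Ideal (MvPolynomial (Fin n) k)) :
    WithBot (WithTop ℤ) :=
  sSup {a | ∃ i j : ℕ, gradedBetti I i j ≠ 0 ∧
    a = (((j : ℤ) - (i : ℤ) : ℤ) : WithBot (WithTop ℤ))}

/-- The depth of the graded `S`-module `S/I`: the supremum of the lengths of the `S/I`-regular
sequences in `𝔪 = (x_1, …, x_n)`. -/
def depth {k : Type*} [Field k] {n : ℕ} (I : Ideal (MvPolynomial (Fin n) k)) : ℕ∞ :=
  sSup {a | ∃ fs : List (MvPolynomial (Fin n) k), (∀ f ∈ fs, f ∈ idealOfVars (Fin n) k) ∧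
    RingTheory.Sequence.IsRegular (MvPolynomial (Fin n) k ⧸ I) fs ∧ a = (fs.length : ℕ∞)}

end

end MonomialBetti

namespace MonomialBetti

open MvPolynomial

/-! Betti numbers: the Taylor complex `T`, with one basis vector `e_τ` for each `τ ⊆ [r]`, resolves
`S/I`, but in general not minimally. The entry of its differential from `e_τ` to a facet `ρ` of `τ`
is `± m_τ / m_ρ`, a unit exactly when `m_τ = m_ρ`. Criticality of `σ` says that no unit occurs in
the row or the column of `σ`, so `e_σ` survives in every graded free resolution `F`. To see this,
take comparison maps `φ : T → F` and `ψ : F → T` and a homotopy `D s + s D = 1 - ψ φ`. At the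
diagonal entry `(σ, σ)` the left side has constant term zero, so that of `ψ φ` is 1. Some basis
vector of `F` in homological degree `|σ|` therefore has a unit coefficient at `e_σ`, and homogeneity
of `ψ` forces its degree to be `deg m_σ` (`GradedFreeResolution.count_ne_zero_of_isCritical`). The
regularity bound follows.

Depth: the bound is obtained from associated primes, without projective dimension. Each `v ∈ σ` has
a private variable in which `u v` strictly exceeds the other members of `σ`. Dividing `m_σ` by these
`|σ|` variables gives a monomial outside `I` that each of them multiplies into `I`. Hence `S/I` has
an associated prime inside `𝔪` of height at least `|σ|`. Passing to the quotient by a regular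
element strictly enlarges such a prime, so at most `n - |σ|` steps are possible
(`height_add_length_le_of_isWeaklyRegular`). -/

/-! ### The augmented chain complex of the full simplex and its contraction by cones. -/

/-- The sign of `v` relative to `τ` in the simplicial boundary. -/
def simplexSign (R : Type*) [CommRing R] {r : ℕ} (v : Fin r) (τ : Finset (Fin r)) : R :=
  (-1) ^ (τ.filter (· < v)).card

theorem simplexSign_mul_self (R : Type*) [CommRing R] {r : ℕ} (v : Fin r) (τ : Finset (Fin r)) :
    simplexSign R v τ * simplexSign R v τ = 1 := by
  rw [simplexSign, ← mul_pow]; simp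

theorem simplexSign_insert_mul (R : Type*) [CommRing R] {r : ℕ} {v w : Fin r}
    {τ : Finset (Fin r)} (hv : v ∉ τ) (hw : w ∉ τ) (hvw : v ≠ w) :
    simplexSign R v τ * simplexSign R w (insert v τ) =
      -(simplexSign R w τ * simplexSign R v (insert w τ)) := by
  unfold simplexSign
  rcases lt_or_gt_of_ne hvw with h | h
  · rw [Finset.filter_insert, Finset.filter_insert, if_pos h, if_neg h.not_gt,
      Finset.card_insert_of_notMem (by simp [hv])]
    ring
  · rw [Finset.filter_insert, Finset.filter_insert, if_neg h.not_gt, if_pos h,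
      Finset.card_insert_of_notMem (by simp [hw])]
    ring

/-- The boundary of the full simplex on `Fin r`, in coordinates. -/
def simplexBoundary (R : Type*) [CommRing R] {r : ℕ} (y : Finset (Fin r) → R)
    (ρ : Finset (Fin r)) : R :=
  ∑ v ∈ ρᶜ, simplexSign R v ρ * y (insert v ρ)

theorem simplexBoundary_simplexBoundary (R : Type*) [CommRing R] {r : ℕ}
    (y : Finset (Fin r) → R) : simplexBoundary R (simplexBoundary R y) = 0 := by
  funext ρ
  simp only [simplexBoundary, Finset.mul_sum, Pi.zero_apply]
  rw [Finset.sum_sigma']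
  refine Finset.sum_involution (fun p _ => ⟨p.2, p.1⟩) ?_ ?_ ?_ ?_
  · rintro ⟨v, w⟩ h
    simp only [Finset.mem_sigma, Finset.mem_compl, Finset.mem_insert, not_or] at h
    have := simplexSign_insert_mul R h.1 h.2.2 (Ne.symm h.2.1)
    simp only [← mul_assoc]
    rw [this, Finset.insert_comm]
    ring
  · rintro ⟨v, w⟩ h _ he
    simp only [Finset.mem_sigma, Finset.mem_compl, Finset.mem_insert, not_or] at h
    simp only [Sigma.mk.injEq] at he
    exact h.2.1 he.1
  · rintro ⟨v, w⟩ h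
    simp only [Finset.mem_sigma, Finset.mem_compl, Finset.mem_insert, not_or] at h ⊢
    exact ⟨h.2.2, Ne.symm h.2.1, h.1⟩
  · rintro ⟨v, w⟩ _
    rfl

/-- The cone with apex `v` over a chain of the full simplex. -/
def simplexCone (R : Type*) [CommRing R] {r : ℕ} (v : Fin r) (y : Finset (Fin r) → R)
    (τ : Finset (Fin r)) : R :=
  if v ∈ τ then simplexSign R v (τ.erase v) * y (τ.erase v) else 0

/-- The cone is a contracting homotopy: `∂ ∘ cone + cone ∘ ∂ = id`, and the second term vanishes on
cycles. For `v ∈ ρ` this compares the boundary of the cone at `ρ` with the cycle condition at `ρ ∖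
{v}`. -/
theorem simplexBoundary_simplexCone (R : Type*) [CommRing R] {r : ℕ} (v : Fin r)
    (y : Finset (Fin r) → R) (hy : simplexBoundary R y = 0) :
    simplexBoundary R (simplexCone R v y) = y := by
  funext ρ
  by_cases hv : v ∈ ρ
  · have h := congrFun hy (ρ.erase v)
    simp only [simplexBoundary, Pi.zero_apply] at h
    rw [Finset.compl_erase, Finset.sum_insert (by simpa using hv), Finset.insert_erase hv] at h
    have hs := simplexSign_mul_self R v (ρ.erase v)
    have key : simplexBoundary R (simplexCone R v y) ρ = -simplexSign R v (ρ.erase v) *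
        ∑ w ∈ ρᶜ, simplexSign R w (ρ.erase v) * y (insert w (ρ.erase v)) := by
      rw [simplexBoundary, Finset.mul_sum]
      refine Finset.sum_congr rfl fun w hw => ?_
      have hw' : w ∉ ρ := by simpa using hw
      have hvw : v ≠ w := fun h => hw' (h ▸ hv)
      have hs' := simplexSign_insert_mul R (Finset.notMem_erase v ρ)
        (fun h => hw' (Finset.mem_of_mem_erase h)) hvw
      rw [Finset.insert_erase hv] at hs'
      rw [simplexCone, if_pos (by simp [hv]), Finset.erase_insert_of_ne hvw.symm]
      have hs2 := simplexSign_mul_self R v (insert w (ρ.erase v))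
      have : simplexSign R w ρ * simplexSign R v (insert w (ρ.erase v)) =
          -(simplexSign R v (ρ.erase v) * simplexSign R w (ρ.erase v)) := by
        linear_combination (simplexSign R w ρ * simplexSign R v (insert w (ρ.erase v))) * -hs
          + (simplexSign R v (ρ.erase v) * simplexSign R v (insert w (ρ.erase v))) * hs'
          - (simplexSign R v (ρ.erase v) * simplexSign R w (ρ.erase v)) * hs2
      linear_combination y (insert w (ρ.erase v)) * this
    rw [key]
    linear_combination (-simplexSign R v (ρ.erase v)) * h + y ρ * hs
  · rw [simplexBoundary, Finset.sum_eq_single v]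
    · rw [simplexCone, if_pos (by simp), Finset.erase_insert hv, ← mul_assoc,
        simplexSign_mul_self, one_mul]
    · intro w _ hw
      rw [simplexCone, if_neg (by simp [hv, hw.symm]), mul_zero]
    · simp [hv]

/-! ### The Taylor complex and its exactness, one multidegree at a time. -/

section Taylor

variable {k : Type*} [Field k] {n r : ℕ} (u : Fin r → (Fin n →₀ ℕ))

theorem lcmExp_mono {σ τ : Finset (Fin r)} (h : σ ⊆ τ) : lcmExp u σ ≤ lcmExp u τ :=
  Finset.sup_mono h

theorem le_lcmExp {v : Fin r} {τ : Finset (Fin r)} (h : v ∈ τ) : u v ≤ lcmExp u τ :=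
  Finset.le_sup h

theorem lcmExp_insert_le {v : Fin r} {τ : Finset (Fin r)} {a : Fin n →₀ ℕ} (hv : u v ≤ a)
    (h : lcmExp u (τ.erase v) ≤ a) : lcmExp u τ ≤ a := by
  refine Finset.sup_le fun w hw => ?_
  by_cases hwv : w = v
  · exact hwv ▸ hv
  · exact (le_lcmExp u (Finset.mem_erase.2 ⟨hwv, hw⟩)).trans h

theorem lcmExp_empty : lcmExp u ∅ = 0 := rfl

theorem mem_monomialIdeal {q : MvPolynomial (Fin n) k} :
    q ∈ monomialIdeal k u ↔ ∀ a ∈ q.support, ∃ v, u v ≤ a := by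
  have : Set.range (fun i => monomial (u i) (1 : k)) =
      (fun s => monomial s (1 : k)) '' Set.range u := by
    rw [← Set.range_comp]; rfl
  rw [monomialIdeal, this, mem_ideal_span_monomial_image]
  simp

/-- The differential of the Taylor complex on the free module with basis the subsets of `Fin r`. -/
noncomputable def taylorDiff (k : Type*) [Field k] {n r : ℕ} (u : Fin r → (Fin n →₀ ℕ)) :
    (Finset (Fin r) → MvPolynomial (Fin n) k) →ₗ[MvPolynomial (Fin n) k]
      (Finset (Fin r) → MvPolynomial (Fin n) k) :=
  LinearMap.pi fun ρ => ∑ v ∈ ρᶜ,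
    (simplexSign (MvPolynomial (Fin n) k) v ρ *
      monomial (lcmExp u (insert v ρ) - lcmExp u ρ) 1) • LinearMap.proj (insert v ρ)

theorem taylorDiff_apply (x : Finset (Fin r) → MvPolynomial (Fin n) k) (ρ : Finset (Fin r)) :
    taylorDiff k u x ρ = ∑ v ∈ ρᶜ, (simplexSign (MvPolynomial (Fin n) k) v ρ *
      monomial (lcmExp u (insert v ρ) - lcmExp u ρ) 1) * x (insert v ρ) := by
  simp [taylorDiff]

/-- Multiplication of the coordinate at `τ` by the monomial `m_τ`. -/
noncomputable def lcmScale (x : Finset (Fin r) → MvPolynomial (Fin n) k) (τ : Finset (Fin r)) :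
    MvPolynomial (Fin n) k :=
  monomial (lcmExp u τ) 1 * x τ

theorem lcmScale_injective :
    Function.Injective (lcmScale (k := k) u) := by
  intro x y h
  funext τ
  exact mul_left_cancel₀ (by simp) (congrFun h τ)

/-- Rescaling each coordinate by `m_τ` clears the quotients `m_τ / m_ρ` and embeds the Taylor
complex in the simplex complex over `S`. Identities such as `D² = 0` are thus inherited from the
simplex. -/
theorem lcmScale_taylorDiff (x : Finset (Fin r) → MvPolynomial (Fin n) k) :
    lcmScale u (taylorDiff k u x) = simplexBoundary _ (lcmScale u x) := by
  funext ρ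
  rw [lcmScale, taylorDiff_apply, simplexBoundary, Finset.mul_sum]
  refine Finset.sum_congr rfl fun v _ => ?_
  have h : monomial (lcmExp u (insert v ρ)) (1 : k) =
      monomial (lcmExp u ρ) 1 * monomial (lcmExp u (insert v ρ) - lcmExp u ρ) 1 := by
    rw [monomial_mul, one_mul, add_tsub_cancel_of_le (lcmExp_mono u (Finset.subset_insert v ρ))]
  rw [lcmScale, h]
  ring

theorem taylorDiff_taylorDiff (x : Finset (Fin r) → MvPolynomial (Fin n) k) :
    taylorDiff k u (taylorDiff k u x) = 0 := by
  apply lcmScale_injective u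
  rw [lcmScale_taylorDiff, lcmScale_taylorDiff, simplexBoundary_simplexBoundary]
  funext τ
  simp [lcmScale]

/-- The family of coefficients at the multidegree `a`. -/
noncomputable def multidegreeSlice (a : Fin n →₀ ℕ)
    (x : Finset (Fin r) → MvPolynomial (Fin n) k) (τ : Finset (Fin r)) : k :=
  coeff a (lcmScale u x τ)

theorem multidegreeSlice_eq_zero {a : Fin n →₀ ℕ} {τ : Finset (Fin r)} (h : ¬ lcmExp u τ ≤ a)
    (x : Finset (Fin r) → MvPolynomial (Fin n) k) : multidegreeSlice u a x τ = 0 := by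
  rw [multidegreeSlice, lcmScale, coeff_monomial_mul', if_neg h]

theorem multidegreeSlice_taylorDiff (a : Fin n →₀ ℕ)
    (x : Finset (Fin r) → MvPolynomial (Fin n) k) :
    multidegreeSlice u a (taylorDiff k u x) = simplexBoundary k (multidegreeSlice u a x) := by
  funext ρ
  rw [multidegreeSlice, lcmScale_taylorDiff, simplexBoundary, simplexBoundary, coeff_sum]
  refine Finset.sum_congr rfl fun v _ => ?_
  have : simplexSign (MvPolynomial (Fin n) k) v ρ = C (simplexSign k v ρ) := by
    simp [simplexSign]
  rw [this, coeff_C_mul, multidegreeSlice]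

theorem multidegreeSlice_ext {x y : Finset (Fin r) → MvPolynomial (Fin n) k}
    (h : ∀ a, multidegreeSlice u a x = multidegreeSlice u a y) : x = y := by
  apply lcmScale_injective u
  funext τ
  ext a
  exact congrFun (h a) τ

/-- Slices may be prescribed freely, provided that they are supported on the `τ` with `m_τ` dividing
`x^a`; the finite set `A` keeps the coordinates polynomial. -/
theorem exists_multidegreeSlice_eq (Y : (Fin n →₀ ℕ) → Finset (Fin r) → k)
    (hY : ∀ a τ, ¬ lcmExp u τ ≤ a → Y a τ = 0) (A : Finset (Fin n →₀ ℕ))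
    (hA : ∀ a, a ∉ A → Y a = 0) :
    ∃ y : Finset (Fin r) → MvPolynomial (Fin n) k, ∀ a, multidegreeSlice u a y = Y a := by
  refine ⟨fun τ => ∑ a ∈ A, monomial (a - lcmExp u τ) (Y a τ), fun a => ?_⟩
  funext τ
  rw [multidegreeSlice, lcmScale, Finset.mul_sum, coeff_sum, Finset.sum_eq_single a]
  · by_cases h : lcmExp u τ ≤ a
    · rw [monomial_mul, add_tsub_cancel_of_le h, one_mul, coeff_monomial, if_pos rfl]
    · simp [hY a τ h]
  · intro b _ hb
    by_cases h : lcmExp u τ ≤ b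
    · rw [monomial_mul, add_tsub_cancel_of_le h, coeff_monomial, if_neg hb]
    · simp [hY b τ h]
  · intro h
    simp [hA a h]

/-- An element of the Taylor complex is homogeneous of degree `d` if its coordinate at `τ` is
homogeneous of degree `d - deg m_τ`. -/
def TaylorHomogeneous (x : Finset (Fin r) → MvPolynomial (Fin n) k) (d : ℕ) : Prop :=
  ∀ τ, (lcmScale u x τ).IsHomogeneous d

/-- In multidegree `a` the complex is that of the full simplex on the `v` with `u v ≤ a`, which is
contracted by a cone over any such `v`. If there is none, only the empty face can contribute, and
membership of `x ∅` in the ideal kills it. A cone has no component at the empty face and uses no new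
multidegree, which gives the last two claims. -/
theorem taylor_exact (x : Finset (Fin r) → MvPolynomial (Fin n) k) (hx : taylorDiff k u x = 0)
    (hx0 : x ∅ ∈ monomialIdeal k u) :
    ∃ y, taylorDiff k u y = x ∧ y ∅ = 0 ∧
      ∀ d, TaylorHomogeneous u x d → TaylorHomogeneous u y d := by
  classical
  set Y : (Fin n →₀ ℕ) → Finset (Fin r) → k := fun a =>
    if h : ∃ v, u v ≤ a then simplexCone k h.choose (multidegreeSlice u a x) else 0 with hYdef
  have hYzero : ∀ a, multidegreeSlice u a x = 0 → Y a = 0 := by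
    intro a ha
    simp only [hYdef]
    split_ifs with h
    · funext τ
      simp [simplexCone, ha]
    · rfl
  -- Since `u v ≤ a` for the apex, coning does not leave the subcomplex of the `τ` with `m_τ`
  -- dividing `x^a`.
  obtain ⟨y, hy⟩ := exists_multidegreeSlice_eq u Y (by
    intro a τ hτ
    simp only [hYdef]
    split_ifs with h
    · rw [simplexCone]
      split_ifs with hm
      · rw [multidegreeSlice_eq_zero u
          (fun h' => hτ (lcmExp_insert_le u h.choose_spec h')), mul_zero]
      · rfl
    · rfl) (Finset.univ.biUnion fun τ => (lcmScale u x τ).support) (by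
    intro a ha
    refine hYzero a (funext fun τ => ?_)
    simp only [Finset.mem_biUnion, Finset.mem_univ, true_and, not_exists] at ha
    exact notMem_support_iff.1 (ha τ))
  refine ⟨y, multidegreeSlice_ext u fun a => ?_, ?_, ?_⟩
  · rw [multidegreeSlice_taylorDiff, hy]
    by_cases h : ∃ v, u v ≤ a
    · simp only [hYdef, dif_pos h]
      refine simplexBoundary_simplexCone k _ _ ?_
      rw [← multidegreeSlice_taylorDiff, hx]
      funext τ
      simp [multidegreeSlice, lcmScale]
    · have h1 : multidegreeSlice u a x = 0 := by
        funext τ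
        rcases τ.eq_empty_or_nonempty with rfl | ⟨v, hv⟩
        · by_contra hne
          obtain ⟨v, hv⟩ := (mem_monomialIdeal u).1 hx0 a
            (mem_support_iff.2 (by simpa [multidegreeSlice, lcmScale, lcmExp_empty] using hne))
          exact h ⟨v, hv⟩
        · exact multidegreeSlice_eq_zero u (fun h' => h ⟨v, (le_lcmExp u hv).trans h'⟩) x
      rw [hYzero a h1, h1]
      funext ρ
      simp [simplexBoundary]
  · have : lcmScale u y ∅ = 0 := by
      ext a
      have := congrFun (hy a) ∅
      rw [multidegreeSlice] at this
      rw [this]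
      simp only [hYdef]
      split_ifs <;> simp [simplexCone]
    rw [lcmScale] at this
    simpa using this
  · intro d hd τ a ha
    have h1 : multidegreeSlice u a x ≠ 0 := by
      intro h0
      apply ha
      have := congrFun (hy a) τ
      rw [hYzero a h0] at this
      exact this
    obtain ⟨ρ, hρ⟩ := Function.ne_iff.1 h1
    exact hd ρ hρ

end Taylor

/-! ### Linear maps on finite free modules, determined by the standard basis. -/

theorem LinearMap.eq_sum_smul_single {R ι M : Type*} [CommSemiring R] [Fintype ι] [DecidableEq ι]
    [AddCommMonoid M] [Module R M] (f : (ι → R) →ₗ[R] M) (x : ι → R) :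
    f x = ∑ i, x i • f (Pi.single i 1) := by
  conv_lhs => rw [← (Pi.basisFun R ι).sum_repr x, map_sum]
  simp

theorem LinearMap.eq_zero_of_single {R ι M : Type*} [CommSemiring R] [Fintype ι] [DecidableEq ι]
    [AddCommMonoid M] [Module R M] (f : (ι → R) →ₗ[R] M) (x : ι → R)
    (h : ∀ i, x i = 0 ∨ f (Pi.single i 1) = 0) : f x = 0 := by
  rw [LinearMap.eq_sum_smul_single]
  refine Finset.sum_eq_zero fun i _ => ?_
  rcases h i with h | h <;> simp [h]

theorem LinearMap.ext_single {R ι M : Type*} [CommSemiring R] [Fintype ι] [DecidableEq ι]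
    [AddCommMonoid M] [Module R M] {f g : (ι → R) →ₗ[R] M}
    (h : ∀ i, f (Pi.single i 1) = g (Pi.single i 1)) (x : ι → R) : f x = g x := by
  simp only [LinearMap.eq_sum_smul_single _ x, h]

/-! ### Comparison of the Taylor complex with an arbitrary graded free resolution. -/

section Comparison

variable {k : Type*} [Field k] {n r : ℕ} (u : Fin r → (Fin n →₀ ℕ))

theorem taylorDiff_single_eq_zero {τ ρ : Finset (Fin r)} (h : ρ.card + 1 ≠ τ.card) :
    taylorDiff k u (Pi.single τ 1) ρ = 0 := by
  rw [taylorDiff_apply]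
  refine Finset.sum_eq_zero fun v hv => ?_
  rw [Pi.single_eq_of_ne, mul_zero]
  rintro rfl
  exact h (Finset.card_insert_of_notMem (by simpa using hv)).symm

theorem taylorDiff_empty_mem (x : Finset (Fin r) → MvPolynomial (Fin n) k) :
    taylorDiff k u x ∅ ∈ monomialIdeal k u := by
  rw [taylorDiff_apply]
  refine Ideal.sum_mem _ fun v _ => Ideal.mul_mem_right _ _ (Ideal.mul_mem_left _ _ ?_)
  have : lcmExp u (insert v ∅) - lcmExp u ∅ = u v := by
    rw [lcmExp_empty, tsub_zero]; simp [lcmExp]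
  rw [this]
  exact Ideal.subset_span ⟨v, rfl⟩

/-- Exactness as a choice function, not required to be linear: it is only applied to images of basis
vectors, from which linear maps are then built. -/
theorem exists_taylor_section :
    ∃ h : (Finset (Fin r) → MvPolynomial (Fin n) k) → (Finset (Fin r) → MvPolynomial (Fin n) k),
      ∀ x, taylorDiff k u x = 0 → x ∅ ∈ monomialIdeal k u →
        taylorDiff k u (h x) = x ∧ h x ∅ = 0 ∧
          ∀ d, TaylorHomogeneous u x d → TaylorHomogeneous u (h x) d := by
  classical
  refine ⟨fun x => if hx : taylorDiff k u x = 0 ∧ x ∅ ∈ monomialIdeal k u then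
    (taylor_exact u x hx.1 hx.2).choose else 0, fun x h1 h2 => ?_⟩
  dsimp only
  rw [dif_pos ⟨h1, h2⟩]
  exact (taylor_exact u x h1 h2).choose_spec

theorem TaylorHomogeneous.sum {ι : Type*} {s : Finset ι}
    {x : ι → Finset (Fin r) → MvPolynomial (Fin n) k} {d : ℕ}
    (h : ∀ i ∈ s, TaylorHomogeneous u (x i) d) : TaylorHomogeneous u (∑ i ∈ s, x i) d := by
  intro τ
  rw [lcmScale, Finset.sum_apply, Finset.mul_sum]
  exact IsHomogeneous.sum _ _ _ fun i hi => h i hi τ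

theorem TaylorHomogeneous.smul {x : Finset (Fin r) → MvPolynomial (Fin n) k} {d e : ℕ}
    {q : MvPolynomial (Fin n) k} (hq : q.IsHomogeneous e) (h : TaylorHomogeneous u x d) :
    TaylorHomogeneous u (q • x) (d + e) := by
  intro τ
  have : lcmScale u (q • x) τ = lcmScale u x τ * q := by
    simp only [lcmScale, Pi.smul_apply, smul_eq_mul]; ring
  rw [this]
  exact (h τ).mul hq

theorem TaylorHomogeneous.zero (d : ℕ) :
    TaylorHomogeneous u (0 : Finset (Fin r) → MvPolynomial (Fin n) k) d := by
  intro τ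
  simpa [lcmScale] using isHomogeneous_zero (Fin n) k d

/-- The usual lifting along an exact complex, started by sending each basis vector of `F_0` to a
homogeneous representative of its augmentation, placed at `∅`. The Taylor module is not split by
cardinality here; only the internal degree is controlled. -/
theorem exists_resolution_to_taylor (F : GradedFreeResolution (monomialIdeal k u)) :
    ∃ ψ : ∀ i, (Fin (F.rank i) → MvPolynomial (Fin n) k) →ₗ[MvPolynomial (Fin n) k]
        (Finset (Fin r) → MvPolynomial (Fin n) k),
      (∀ i b, TaylorHomogeneous u (ψ i (Pi.single b 1)) (F.deg i b)) ∧
      (∀ i x, taylorDiff k u (ψ (i + 1) x) = ψ i (F.diff i x)) ∧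
      (∀ x, taylorDiff k u (ψ 0 x) = 0) ∧
      (∀ x, Ideal.Quotient.mk _ (ψ 0 x ∅) = F.aug x) ∧
      ∀ i x, ψ (i + 1) x ∅ = 0 := by
  classical
  obtain ⟨h, hh⟩ := exists_taylor_section (k := k) u
  choose f hf hfaug using F.aug_homogeneous
  let ψ : ∀ i, (Fin (F.rank i) → MvPolynomial (Fin n) k) →ₗ[MvPolynomial (Fin n) k]
      (Finset (Fin r) → MvPolynomial (Fin n) k) := fun i =>
    Nat.rec ((Pi.basisFun _ _).constr ℕ fun b => Pi.single ∅ (f b))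
      (fun i ψi => (Pi.basisFun _ _).constr ℕ fun b => h (ψi (F.diff i (Pi.single b 1)))) i
  have hψ0 : ∀ b, ψ 0 (Pi.single b 1) = Pi.single ∅ (f b) := fun b => by
    have := (Pi.basisFun (MvPolynomial (Fin n) k) (Fin (F.rank 0))).constr_basis ℕ
      (fun b => (Pi.single ∅ (f b) : Finset (Fin r) → MvPolynomial (Fin n) k)) b
    rwa [Pi.basisFun_apply] at this
  have hψs : ∀ i b, ψ (i + 1) (Pi.single b 1) = h (ψ i (F.diff i (Pi.single b 1))) :=
    fun i b => by
    have := (Pi.basisFun (MvPolynomial (Fin n) k) (Fin (F.rank (i + 1)))).constr_basis ℕ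
      (fun b => h (ψ i (F.diff i (Pi.single b 1)))) b
    rwa [Pi.basisFun_apply] at this
  clear_value ψ
  have hD0 : ∀ x, taylorDiff k u (ψ 0 x) = 0 := by
    refine LinearMap.ext_single (f := taylorDiff k u ∘ₗ ψ 0) (g := 0) fun b => ?_
    rw [LinearMap.comp_apply, hψ0]
    funext ρ
    rw [taylorDiff_apply]
    exact Finset.sum_eq_zero fun v _ => by
      rw [Pi.single_eq_of_ne (Finset.insert_ne_empty v ρ), mul_zero]
  have haug : ∀ x, Ideal.Quotient.mk _ (ψ 0 x ∅) = F.aug x := by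
    refine LinearMap.ext_single
      (f := Submodule.mkQ (monomialIdeal k u) ∘ₗ LinearMap.proj ∅ ∘ₗ ψ 0) fun b => ?_
    rw [hfaug]
    simp [hψ0]
  have hinv : ∀ i, (∀ b, TaylorHomogeneous u (ψ i (Pi.single b 1)) (F.deg i b)) ∧
      ∀ x, taylorDiff k u (ψ i (F.diff i x)) = 0 ∧
        ψ i (F.diff i x) ∅ ∈ monomialIdeal k u := by
    intro i
    induction i with
    | zero =>
      refine ⟨fun b τ => ?_, fun x => ⟨hD0 _, ?_⟩⟩
      · rw [hψ0, lcmScale]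
        by_cases hτ : τ = ∅
        · subst hτ
          simpa [lcmExp_empty] using hf b
        · rw [Pi.single_eq_of_ne hτ, mul_zero]
          exact isHomogeneous_zero _ _ _
      · rw [← Ideal.Quotient.eq_zero_iff_mem, haug]
        exact F.exact_zero.apply_apply_eq_zero x
    | succ i ih =>
      have h1 : ∀ x, taylorDiff k u (ψ (i + 1) x) = ψ i (F.diff i x) := by
        refine LinearMap.ext_single (f := taylorDiff k u ∘ₗ ψ (i + 1)) (g := ψ i ∘ₗ F.diff i)
          fun b => ?_
        rw [LinearMap.comp_apply, hψs]
        exact (hh _ (ih.2 _).1 (ih.2 _).2).1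
      have h2 : ∀ x, ψ (i + 1) x ∅ = 0 := by
        refine LinearMap.ext_single (f := LinearMap.proj ∅ ∘ₗ ψ (i + 1)) (g := 0)
          fun b => ?_
        rw [LinearMap.comp_apply, hψs]
        exact (hh _ (ih.2 _).1 (ih.2 _).2).2.1
      refine ⟨fun b => ?_, fun x => ⟨?_, ?_⟩⟩
      · rw [hψs]
        refine (hh _ (ih.2 _).1 (ih.2 _).2).2.2 _ ?_
        rw [LinearMap.eq_sum_smul_single (ψ i)]
        refine TaylorHomogeneous.sum u fun c _ => ?_
        rcases F.diff_homogeneous i b c with h0 | ⟨e, he, hd⟩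
        · rw [h0, zero_smul]
          exact TaylorHomogeneous.zero u _
        · rw [← hd]
          exact TaylorHomogeneous.smul u he (ih.1 c)
      · rw [h1, (F.exact_succ i).apply_apply_eq_zero, map_zero]
      · rw [h2]
        exact Ideal.zero_mem _
  refine ⟨ψ, fun i => (hinv i).1, fun i => ?_, hD0, haug, fun i => ?_⟩
  · refine LinearMap.ext_single (f := taylorDiff k u ∘ₗ ψ (i + 1)) (g := ψ i ∘ₗ F.diff i)
      fun b => ?_
    rw [LinearMap.comp_apply, hψs]
    exact (hh _ ((hinv i).2 _).1 ((hinv i).2 _).2).1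
  · refine LinearMap.ext_single (f := LinearMap.proj ∅ ∘ₗ ψ (i + 1)) (g := 0) fun b => ?_
    rw [LinearMap.comp_apply, hψs]
    exact (hh _ ((hinv i).2 _).1 ((hinv i).2 _).2).2.1

/-- The Taylor differential lowers cardinality by one, so lifting proceeds by cardinality. Vanishing
of `φ i` off the subsets of size `i` carries the homological degree; internal homogeneity is needed
only for the map in the other direction. -/
theorem exists_taylor_to_resolution (F : GradedFreeResolution (monomialIdeal k u)) :
    ∃ φ : ∀ i, (Finset (Fin r) → MvPolynomial (Fin n) k) →ₗ[MvPolynomial (Fin n) k]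
        (Fin (F.rank i) → MvPolynomial (Fin n) k),
      (∀ i τ, τ.card ≠ i → φ i (Pi.single τ 1) = 0) ∧
      (∀ i x, F.diff i (φ (i + 1) x) = φ i (taylorDiff k u x)) ∧
      ∀ x, F.aug (φ 0 x) = Ideal.Quotient.mk _ (x ∅) := by
  classical
  obtain ⟨e, he⟩ := F.aug_surjective 1
  let φ : ∀ i, (Finset (Fin r) → MvPolynomial (Fin n) k) →ₗ[MvPolynomial (Fin n) k]
        (Fin (F.rank i) → MvPolynomial (Fin n) k) := fun i =>
    Nat.rec ((Pi.basisFun _ _).constr ℕ fun τ => if τ = ∅ then e else 0)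
      (fun i φi => (Pi.basisFun _ _).constr ℕ fun τ => if τ.card = i + 1 then
        Function.invFun (F.diff i) (φi (taylorDiff k u (Pi.single τ 1))) else 0) i
  have hφ0 : ∀ τ, φ 0 (Pi.single τ 1) = if τ = ∅ then e else 0 := fun τ => by
    have := (Pi.basisFun (MvPolynomial (Fin n) k) (Finset (Fin r))).constr_basis ℕ
      (fun τ => if τ = ∅ then e else 0) τ
    rwa [Pi.basisFun_apply] at this
  have hφs : ∀ i τ, φ (i + 1) (Pi.single τ 1) = if τ.card = i + 1 then
        Function.invFun (F.diff i) (φ i (taylorDiff k u (Pi.single τ 1))) else 0 :=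
    fun i τ => by
    have := (Pi.basisFun (MvPolynomial (Fin n) k) (Finset (Fin r))).constr_basis ℕ
      (fun τ => if τ.card = i + 1 then
        Function.invFun (F.diff i) (φ i (taylorDiff k u (Pi.single τ 1))) else 0) τ
    rwa [Pi.basisFun_apply] at this
  clear_value φ
  have hcard : ∀ i τ, τ.card ≠ i → φ i (Pi.single τ 1) = 0 := by
    rintro (_ | i) τ h
    · rw [hφ0, if_neg (by simpa using h)]
    · rw [hφs, if_neg h]
  have haug : ∀ x, F.aug (φ 0 x) = Ideal.Quotient.mk _ (x ∅) := by
    refine LinearMap.ext_single (f := F.aug ∘ₗ φ 0)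
      (g := Submodule.mkQ (monomialIdeal k u) ∘ₗ LinearMap.proj ∅) fun τ => ?_
    rw [LinearMap.comp_apply, hφ0]
    by_cases h : τ = ∅
    · subst h
      simpa using he
    · simp [h]
  have hstep : ∀ i, (∀ x, φ i (taylorDiff k u x) ∈ LinearMap.range (F.diff i)) →
      ∀ x, F.diff i (φ (i + 1) x) = φ i (taylorDiff k u x) := by
    intro i ih
    refine LinearMap.ext_single (f := F.diff i ∘ₗ φ (i + 1)) (g := φ i ∘ₗ taylorDiff k u)
      fun τ => ?_
    rw [LinearMap.comp_apply, LinearMap.comp_apply, hφs]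
    split_ifs with h
    · exact Function.invFun_eq (ih (Pi.single τ 1))
    · rw [map_zero]
      refine (LinearMap.eq_zero_of_single (φ i) _ fun ρ => ?_).symm
      by_cases hρ : ρ.card = i
      · exact Or.inl (taylorDiff_single_eq_zero u (by omega))
      · exact Or.inr (hcard i ρ hρ)
  have hinv : ∀ i x, φ i (taylorDiff k u x) ∈ LinearMap.range (F.diff i) := by
    intro i
    induction i with
    | zero =>
      intro x
      refine (F.exact_zero _).1 ?_
      rw [haug, Ideal.Quotient.eq_zero_iff_mem]
      exact taylorDiff_empty_mem u x
    | succ i ih =>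
      intro x
      refine (F.exact_succ i _).1 ?_
      rw [hstep i ih, taylorDiff_taylorDiff, map_zero]
  exact ⟨φ, hcard, fun i => hstep i (hinv i), haug⟩

theorem exists_taylor_homotopy
    (Θ : (Finset (Fin r) → MvPolynomial (Fin n) k) →ₗ[MvPolynomial (Fin n) k]
      (Finset (Fin r) → MvPolynomial (Fin n) k))
    (hΘ : ∀ x, taylorDiff k u (Θ x) = Θ (taylorDiff k u x))
    (hΘ0 : ∀ x, x ∅ - Θ x ∅ ∈ monomialIdeal k u) :
    ∃ s : (Finset (Fin r) → MvPolynomial (Fin n) k) →ₗ[MvPolynomial (Fin n) k]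
      (Finset (Fin r) → MvPolynomial (Fin n) k),
      ∀ x, taylorDiff k u (s x) + s (taylorDiff k u x) = x - Θ x := by
  classical
  obtain ⟨h, hh⟩ := exists_taylor_section (k := k) u
  -- The homotopy is built by cardinality: stage `j` makes the identity hold on basis vectors of
  -- size less than `j`.
  suffices H : ∀ j : ℕ, ∃ s : (Finset (Fin r) → MvPolynomial (Fin n) k) →ₗ[MvPolynomial (Fin n) k]
      (Finset (Fin r) → MvPolynomial (Fin n) k), (∀ x, s x ∅ = 0) ∧
      ∀ τ : Finset (Fin r), τ.card < j → taylorDiff k u (s (Pi.single τ 1)) +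
        s (taylorDiff k u (Pi.single τ 1)) = Pi.single τ 1 - Θ (Pi.single τ 1) by
    obtain ⟨s, _, hs⟩ := H (r + 1)
    refine ⟨s, LinearMap.ext_single (f := taylorDiff k u ∘ₗ s + s ∘ₗ taylorDiff k u)
      (g := LinearMap.id - Θ) fun τ => hs τ ?_⟩
    have := Finset.card_le_univ τ
    rw [Fintype.card_fin] at this
    omega
  intro j
  induction j with
  | zero => exact ⟨0, by simp, by simp⟩
  | succ j ih =>
    obtain ⟨s, hs0, hs⟩ := ih
    let g : Finset (Fin r) → (Finset (Fin r) → MvPolynomial (Fin n) k) := fun τ =>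
      Pi.single τ 1 - Θ (Pi.single τ 1) - s (taylorDiff k u (Pi.single τ 1))
    let s' := (Pi.basisFun (MvPolynomial (Fin n) k) (Finset (Fin r))).constr ℕ
      (fun τ => if τ.card = j then h (g τ) else s (Pi.single τ 1))
    have hs' : ∀ τ, s' (Pi.single τ 1) = if τ.card = j then h (g τ) else s (Pi.single τ 1) :=
      fun τ => by
      have := (Pi.basisFun (MvPolynomial (Fin n) k) (Finset (Fin r))).constr_basis ℕ
        (fun τ => if τ.card = j then h (g τ) else s (Pi.single τ 1)) τ
      rwa [Pi.basisFun_apply] at this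
    clear_value s'
    have hg : ∀ τ : Finset (Fin r), τ.card = j →
        taylorDiff k u (g τ) = 0 ∧ g τ ∅ ∈ monomialIdeal k u := by
      intro τ hτ
      constructor
      -- The boundary of `e_τ` involves only faces of size `j - 1`, where the homotopy identity
      -- already holds; applied there, it shows that `g τ` is a cycle.
      · have := LinearMap.eq_zero_of_single
          (taylorDiff k u ∘ₗ s + s ∘ₗ taylorDiff k u - (LinearMap.id - Θ))
          (taylorDiff k u (Pi.single τ 1)) (fun ρ => by
            by_cases hρ : ρ.card < j
            · exact Or.inr (sub_eq_zero.2 (hs ρ hρ))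
            · exact Or.inl (taylorDiff_single_eq_zero u (by omega)))
        simp only [LinearMap.sub_apply, LinearMap.add_apply, LinearMap.comp_apply,
          LinearMap.id_apply, taylorDiff_taylorDiff, map_zero, add_zero] at this
        rw [map_sub, map_sub, hΘ, sub_eq_zero.1 this, sub_self]
      · simp only [g, Pi.sub_apply, hs0, sub_zero]
        exact hΘ0 _
    refine ⟨s', ?_, fun τ hτ => ?_⟩
    · refine LinearMap.ext_single (f := LinearMap.proj ∅ ∘ₗ s') (g := 0) fun τ => ?_
      rw [LinearMap.comp_apply, hs']
      split_ifs with hτ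
      · exact (hh _ (hg τ hτ).1 (hg τ hτ).2).2.1
      · exact hs0 _
    · have hss : s' (taylorDiff k u (Pi.single τ 1)) = s (taylorDiff k u (Pi.single τ 1)) := by
        refine sub_eq_zero.1 (LinearMap.eq_zero_of_single (s' - s) _ fun ρ => ?_)
        by_cases hρ : ρ.card = j
        · exact Or.inl (taylorDiff_single_eq_zero u (by omega))
        · exact Or.inr (by rw [LinearMap.sub_apply, hs', if_neg hρ, sub_self])
      rw [hss, hs']
      split_ifs with hτj
      · rw [(hh _ (hg τ hτj).1 (hg τ hτj).2).1]
        simp [g]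
      · exact hs τ (by omega)

/-- The row of `σ` has no unit entry: this is the half of criticality about adding a vertex. -/
theorem constantCoeff_taylorDiff_of_isCritical {σ : Finset (Fin r)} (hσ : IsCritical u σ)
    (x : Finset (Fin r) → MvPolynomial (Fin n) k) :
    constantCoeff (taylorDiff k u x σ) = 0 := by
  rw [taylorDiff_apply, map_sum]
  refine Finset.sum_eq_zero fun v hv => ?_
  have h1 := hσ.2 v (by simpa using hv)
  have : lcmExp u (insert v σ) - lcmExp u σ ≠ 0 := fun h =>
    h1 (le_antisymm (lcmExp_mono u (Finset.subset_insert v σ)) (tsub_eq_zero_iff_le.1 h))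
  simp [constantCoeff_monomial, this]

/-- The column of `σ` has no unit entry: this is the half of criticality about deleting a vertex. -/
theorem constantCoeff_taylorDiff_single_of_isCritical {σ : Finset (Fin r)}
    (hσ : IsCritical u σ) (ρ : Finset (Fin r)) :
    constantCoeff (taylorDiff k u (Pi.single σ 1) ρ) = 0 := by
  rw [taylorDiff_apply, map_sum]
  refine Finset.sum_eq_zero fun v hv => ?_
  by_cases h : insert v ρ = σ
  · subst h
    have hv' : v ∉ ρ := by simpa using hv
    have h1 := hσ.1 v (Finset.mem_insert_self v ρ)
    rw [Finset.erase_insert hv'] at h1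
    have : lcmExp u (insert v ρ) - lcmExp u ρ ≠ 0 := fun h =>
      h1 (le_antisymm (tsub_eq_zero_iff_le.1 h) (lcmExp_mono u (Finset.subset_insert v ρ)))
    simp [constantCoeff_monomial, this]
  · rw [Pi.single_eq_of_ne h, mul_zero, map_zero]

/-- Every graded free resolution of `S/I`, minimal or not, has a summand `S(-deg m_σ)` in
homological degree `|σ|` if `σ` is critical. -/
theorem GradedFreeResolution.count_ne_zero_of_isCritical
    (F : GradedFreeResolution (monomialIdeal k u)) {σ : Finset (Fin r)} (hσ : IsCritical u σ) :
    F.count σ.card (lcmExp u σ).degree ≠ 0 := by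
  classical
  obtain ⟨ψ, hψhom, hψD, hψ0, hψaug, hψe⟩ := exists_resolution_to_taylor u F
  obtain ⟨φ, hφcard, hφD, hφaug⟩ := exists_taylor_to_resolution u F
  let Θ : (Finset (Fin r) → MvPolynomial (Fin n) k) →ₗ[MvPolynomial (Fin n) k]
      (Finset (Fin r) → MvPolynomial (Fin n) k) := ∑ i ∈ Finset.range (r + 1), ψ i ∘ₗ φ i
  have hΘ : ∀ x, Θ x = ∑ i ∈ Finset.range (r + 1), ψ i (φ i x) := by
    intro x
    simp [Θ]
  have hcard : ∀ τ : Finset (Fin r), τ.card < r + 1 := fun τ => by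
    have := Finset.card_le_univ τ
    rw [Fintype.card_fin] at this
    omega
  have htop : ∀ x, φ (r + 1) x = 0 := fun x =>
    LinearMap.eq_zero_of_single _ _ fun τ => Or.inr (hφcard _ τ (hcard τ).ne)
  -- `Θ` commutes with `D` after a shift of the summation index; the leftover top term is `ψ r
  -- (F.diff r (φ (r + 1) x))`, which is zero as no subset has `r + 1` elements. At `∅` only the
  -- term `i = 0` survives, and it is the identity modulo the ideal.
  obtain ⟨s, hs⟩ := exists_taylor_homotopy u Θ (fun x => by
    rw [hΘ, hΘ, map_sum, Finset.sum_range_succ', Finset.sum_range_succ, hψ0, ← hφD r, htop]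
    simp only [hψD, hφD, map_zero]) (fun x => by
    rw [hΘ, Finset.sum_apply, Finset.sum_range_succ']
    simp only [hψe, Finset.sum_const_zero, zero_add]
    rw [← Ideal.Quotient.eq_zero_iff_mem, map_sub, hψaug, hφaug, sub_self])
  have h1 : constantCoeff (Θ (Pi.single σ 1) σ) = 1 := by
    have h := congrArg constantCoeff (congrFun (hs (Pi.single σ 1)) σ)
    rw [Pi.add_apply, map_add, constantCoeff_taylorDiff_of_isCritical u hσ, zero_add,
      LinearMap.eq_sum_smul_single s, Finset.sum_apply, map_sum, Finset.sum_eq_zero] at h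
    · rw [Pi.sub_apply, map_sub, Pi.single_eq_same, map_one] at h
      exact (sub_eq_zero.1 h.symm).symm
    · intro ρ _
      rw [Pi.smul_apply, smul_eq_mul, map_mul,
        constantCoeff_taylorDiff_single_of_isCritical u hσ, zero_mul]
  rw [hΘ, Finset.sum_eq_single σ.card (fun i _ hi => by rw [hφcard i σ hi.symm, map_zero])
    (fun h => absurd (Finset.mem_range.2 (hcard σ)) h), LinearMap.eq_sum_smul_single (ψ _),
    Finset.sum_apply, map_sum] at h1
  obtain ⟨c, _, hc⟩ := Finset.exists_ne_zero_of_sum_ne_zero (h1.trans_ne one_ne_zero)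
  rw [Pi.smul_apply, smul_eq_mul, map_mul] at hc
  have hdeg : F.deg σ.card c = (lcmExp u σ).degree := by
    by_contra hne
    -- The constant term of the coordinate at `σ` is the coefficient of `m_σ` after rescaling, and
    -- that vanishes unless the degrees agree.
    have := (hψhom σ.card c σ).coeff_eq_zero (d := lcmExp u σ) (Ne.symm hne)
    rw [lcmScale, coeff_monomial_mul', if_pos le_rfl, tsub_self, one_mul] at this
    exact right_ne_zero_of_mul hc this
  exact Finset.card_ne_zero_of_mem (Finset.mem_filter.2 ⟨Finset.mem_univ c, hdeg⟩)

end Comparison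

/-! ### Existence of minimal graded free resolutions. -/

section MinimalResolution

variable {k : Type*} [Field k] {n : ℕ}

theorem mem_idealOfVars_iff {q : MvPolynomial (Fin n) k} :
    q ∈ idealOfVars (Fin n) k ↔ constantCoeff q = 0 := by
  have := mem_pow_idealOfVars_iff' 1 q
  rw [pow_one] at this
  rw [this, constantCoeff_eq]
  refine ⟨fun h => h 0 (by simp), fun h a ha => ?_⟩
  rw [Nat.lt_one_iff, Finsupp.degree_eq_zero_iff] at ha
  rw [ha, h]

/-- The component of degree `e` of a multiple of a basis vector of degree `d`. -/
noncomputable def shiftedComponent (d e : ℕ) :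
    MvPolynomial (Fin n) k →ₗ[k] MvPolynomial (Fin n) k :=
  if d ≤ e then homogeneousComponent (e - d) else 0

theorem coeff_shiftedComponent (d e : ℕ) (q : MvPolynomial (Fin n) k) (a : Fin n →₀ ℕ) :
    coeff a (shiftedComponent d e q) = if a.degree + d = e then coeff a q else 0 := by
  rw [shiftedComponent]
  split_ifs with h h' h'
  · rw [coeff_homogeneousComponent, if_pos (by omega)]
  · rw [coeff_homogeneousComponent, if_neg (by omega)]
  · omega
  · simp

theorem shiftedComponent_self (d : ℕ) (q : MvPolynomial (Fin n) k) :
    shiftedComponent d d q = C (constantCoeff q) := by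
  simp [shiftedComponent, constantCoeff_eq]

theorem shiftedComponent_mul {d e t : ℕ} (q : MvPolynomial (Fin n) k)
    {f : MvPolynomial (Fin n) k} (hf : f.IsHomogeneous t) :
    shiftedComponent d e (q * f) = shiftedComponent (d + t) e q * f := by
  induction q using MvPolynomial.induction_on' with
  | monomial a c =>
    have h1 : (monomial a c : MvPolynomial (Fin n) k).IsHomogeneous a.degree :=
      isHomogeneous_monomial c rfl
    have h2 := h1.mul hf
    unfold shiftedComponent
    by_cases hd : d + t ≤ e
    · rw [if_pos hd, if_pos (by omega), homogeneousComponent_of_mem h2,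
        homogeneousComponent_of_mem h1]
      by_cases ha : e - (d + t) = a.degree
      · rw [if_pos ha, if_pos (by omega)]
      · rw [if_neg ha, if_neg (by omega), zero_mul]
    · rw [if_neg hd]
      by_cases hd' : d ≤ e
      · rw [if_pos hd', homogeneousComponent_of_mem h2, if_neg (by omega)]
        simp
      · rw [if_neg hd']
        simp
  | add p q hp hq => rw [add_mul, map_add, hp, hq, map_add, add_mul]

theorem sum_shiftedComponent (d : ℕ) (q : MvPolynomial (Fin n) k) {N : ℕ}
    (hN : q.totalDegree + d < N) : ∑ e ∈ Finset.range N, shiftedComponent d e q = q := by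
  ext a
  rw [coeff_sum]
  simp only [coeff_shiftedComponent, Finset.sum_ite_eq, Finset.mem_range]
  split_ifs with h
  · rfl
  · refine (coeff_eq_zero_of_totalDegree_lt ?_).symm
    have : ∑ i ∈ a.support, a i = a.degree := rfl
    omega

/-- The component of degree `e` of an element of the free module whose basis vectors have the
degrees `d`. -/
noncomputable def vectorComponent {s : ℕ} (d : Fin s → ℕ) (e : ℕ)
    (x : Fin s → MvPolynomial (Fin n) k) : Fin s → MvPolynomial (Fin n) k :=
  fun c => shiftedComponent (d c) e (x c)

/-- Homogeneity of degree `e` in the free module whose basis vectors have the degrees `d`. -/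
def VectorHomogeneous {s : ℕ} (d : Fin s → ℕ) (e : ℕ)
    (x : Fin s → MvPolynomial (Fin n) k) : Prop :=
  ∀ c, x c = 0 ∨ ∃ t, (x c).IsHomogeneous t ∧ d c + t = e

theorem vectorHomogeneous_vectorComponent {s : ℕ} (d : Fin s → ℕ) (e : ℕ)
    (x : Fin s → MvPolynomial (Fin n) k) : VectorHomogeneous d e (vectorComponent d e x) := by
  intro c
  rw [vectorComponent, shiftedComponent]
  split_ifs with h
  · exact Or.inr ⟨e - d c, homogeneousComponent_isHomogeneous _ _, by omega⟩
  · exact Or.inl rfl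

theorem vectorComponent_sum {ι : Type*} {s : ℕ} (d : Fin s → ℕ) (e : ℕ) (A : Finset ι)
    (x : ι → Fin s → MvPolynomial (Fin n) k) :
    vectorComponent d e (∑ i ∈ A, x i) = ∑ i ∈ A, vectorComponent d e (x i) := by
  funext c
  simp [vectorComponent]

theorem vectorComponent_smul {s : ℕ} (d : Fin s → ℕ) (e : ℕ) {e' : ℕ}
    (q : MvPolynomial (Fin n) k) {x : Fin s → MvPolynomial (Fin n) k}
    (hx : VectorHomogeneous d e' x) :
    vectorComponent d e (q • x) = shiftedComponent e' e q • x := by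
  funext c
  rw [vectorComponent, Pi.smul_apply, Pi.smul_apply, smul_eq_mul, smul_eq_mul]
  rcases hx c with h | ⟨t, ht, hd⟩
  · rw [h]
    simp
  · rw [shiftedComponent_mul q ht, hd]

theorem vectorComponent_map {s s' : ℕ} (d : Fin s → ℕ) (d' : Fin s' → ℕ) (e : ℕ)
    (φ : (Fin s' → MvPolynomial (Fin n) k) →ₗ[MvPolynomial (Fin n) k]
      (Fin s → MvPolynomial (Fin n) k))
    (hφ : ∀ b, VectorHomogeneous d (d' b) (φ (Pi.single b 1)))
    (y : Fin s' → MvPolynomial (Fin n) k) :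
    vectorComponent d e (φ y) = φ (vectorComponent d' e y) := by
  rw [LinearMap.eq_sum_smul_single φ y, LinearMap.eq_sum_smul_single φ, vectorComponent_sum]
  exact Finset.sum_congr rfl fun b _ => vectorComponent_smul d e _ (hφ b)

theorem exists_sum_vectorComponent {s : ℕ} (d : Fin s → ℕ)
    (x : Fin s → MvPolynomial (Fin n) k) :
    ∃ N, ∑ e ∈ Finset.range N, vectorComponent d e x = x := by
  refine ⟨(Finset.univ.sup fun c => (x c).totalDegree + d c) + 1, ?_⟩
  funext c
  rw [Finset.sum_apply]
  refine sum_shiftedComponent (d c) (x c) (Nat.lt_succ_of_le ?_)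
  exact Finset.le_sup (f := fun c => (x c).totalDegree + d c) (Finset.mem_univ c)

/-- A submodule of the free module with basis vectors of degrees `d` is graded. -/
def IsGradedSubmodule {s : ℕ} (d : Fin s → ℕ)
    (K : Submodule (MvPolynomial (Fin n) k) (Fin s → MvPolynomial (Fin n) k)) : Prop :=
  ∀ x ∈ K, ∀ e, vectorComponent d e x ∈ K

/-- The family `b` consists of homogeneous generators, of degrees `d'`, of `K`. -/
def IsHomogeneousGenerators {s m : ℕ} (d : Fin s → ℕ)
    (K : Submodule (MvPolynomial (Fin n) k) (Fin s → MvPolynomial (Fin n) k))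
    (d' : Fin m → ℕ) (b : Fin m → Fin s → MvPolynomial (Fin n) k) : Prop :=
  (∀ i, VectorHomogeneous d (d' i) (b i)) ∧
    Submodule.span (MvPolynomial (Fin n) k) (Set.range b) = K

theorem exists_isHomogeneousGenerators {s : ℕ} {d : Fin s → ℕ}
    {K : Submodule (MvPolynomial (Fin n) k) (Fin s → MvPolynomial (Fin n) k)}
    (hK : IsGradedSubmodule d K) :
    ∃ (m : ℕ) (d' : Fin m → ℕ) (b : Fin m → Fin s → MvPolynomial (Fin n) k),
      IsHomogeneousGenerators d K d' b := by
  have hspan : Submodule.span (MvPolynomial (Fin n) k)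
      {x | x ∈ K ∧ ∃ e, VectorHomogeneous d e x} = K := by
    refine le_antisymm (Submodule.span_le.2 fun x hx => hx.1) fun x hx => ?_
    obtain ⟨N, hN⟩ := exists_sum_vectorComponent d x
    rw [← hN]
    exact Submodule.sum_mem _ fun e _ => Submodule.subset_span
      ⟨hK x hx e, e, vectorHomogeneous_vectorComponent d e x⟩
  have hfg : K.FG := IsNoetherian.noetherian K
  rw [← hspan, Submodule.fg_span_iff_fg_span_finset_subset] at hfg
  obtain ⟨A, hA, hAspan⟩ := hfg
  rw [hspan] at hAspan
  choose! f hf using fun x (hx : x ∈ A) => (hA hx).2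
  refine ⟨A.card, fun i => f (A.equivFin.symm i), fun i => A.equivFin.symm i,
    fun i => hf _ (A.equivFin.symm i).2, ?_⟩
  rw [hAspan]
  congr 1
  ext x
  constructor
  · rintro ⟨i, rfl⟩
    exact (A.equivFin.symm i).2
  · intro hx
    exact ⟨A.equivFin ⟨x, hx⟩, by simp⟩

/-- Graded Nakayama: take the least possible number of homogeneous generators. A relation in which
some coefficient has nonzero constant term would make that generator redundant. -/
theorem exists_minimal_homogeneousGenerators {s : ℕ} {d : Fin s → ℕ}
    {K : Submodule (MvPolynomial (Fin n) k) (Fin s → MvPolynomial (Fin n) k)}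
    (hK : IsGradedSubmodule d K) :
    ∃ (m : ℕ) (d' : Fin m → ℕ) (b : Fin m → Fin s → MvPolynomial (Fin n) k),
      IsHomogeneousGenerators d K d' b ∧
        ∀ a : Fin m → MvPolynomial (Fin n) k, ∑ i, a i • b i = 0 →
          ∀ i, a i ∈ idealOfVars (Fin n) k := by
  classical
  have hex := exists_isHomogeneousGenerators hK
  obtain ⟨d', b, hb⟩ := Nat.find_spec hex
  refine ⟨_, d', b, hb, fun a ha i => ?_⟩
  rw [mem_idealOfVars_iff]
  by_contra hai
  have hmin := fun m => Nat.find_min hex (m := m)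
  generalize Nat.find hex = m at *
  obtain ⟨m, rfl⟩ : ∃ m', m = m' + 1 := ⟨m - 1, by have := i.2; omega⟩
  refine hmin m (Nat.lt_succ_self m) ⟨d' ∘ i.succAbove, b ∘ i.succAbove,
    fun j => hb.1 _, ?_⟩
  refine le_antisymm ?_ ?_
  · rw [← hb.2]
    exact Submodule.span_mono (Set.range_comp_subset_range _ _)
  · have hother : ∀ j, b (i.succAbove j) ∈
        Submodule.span (MvPolynomial (Fin n) k) (Set.range (b ∘ i.succAbove)) :=
      fun j => Submodule.subset_span ⟨j, rfl⟩
    -- In the component of the relation of degree `d' i`, the coefficient of `b i` becomes its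
    -- constant term, which is invertible.
    have h0 : ∑ j, shiftedComponent (d' j) (d' i) (a j) • b j = 0 := by
      have := congrArg (vectorComponent d (d' i)) ha
      rw [vectorComponent_sum] at this
      rw [← Finset.sum_congr rfl fun j (_ : j ∈ Finset.univ) =>
        vectorComponent_smul d (d' i) (a j) (hb.1 j), this]
      funext c
      simp [vectorComponent]
    rw [Fin.sum_univ_succAbove _ i, shiftedComponent_self] at h0
    have hi : b i ∈ Submodule.span (MvPolynomial (Fin n) k) (Set.range (b ∘ i.succAbove)) := by
      have h1 : (C (constantCoeff (a i)) : MvPolynomial (Fin n) k) • b i ∈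
          Submodule.span (MvPolynomial (Fin n) k) (Set.range (b ∘ i.succAbove)) := by
        rw [eq_neg_of_add_eq_zero_left h0]
        exact Submodule.neg_mem _ (Submodule.sum_mem _ fun j _ =>
          Submodule.smul_mem _ _ (hother j))
      have h2 := Submodule.smul_mem _ (C (constantCoeff (a i))⁻¹) h1
      rwa [smul_smul, ← C_mul, inv_mul_cancel₀ hai, C_1, one_smul] at h2
    rw [← hb.2, Submodule.span_le]
    rintro _ ⟨j, rfl⟩
    by_cases hj : j = i
    · exact hj ▸ hi
    · obtain ⟨j', rfl⟩ := Fin.exists_succAbove_eq hj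
      exact hother j'

/-- A graded free module with a graded submodule contained in `𝔪` times the module: the kernel of
one of the maps of a minimal graded free resolution. -/
structure MinimalSyzygy (k : Type*) [Field k] (n : ℕ) where
  rank : ℕ
  deg : Fin rank → ℕ
  ker : Submodule (MvPolynomial (Fin n) k) (Fin rank → MvPolynomial (Fin n) k)
  isGraded : IsGradedSubmodule deg ker
  le : ∀ x ∈ ker, ∀ c, x c ∈ idealOfVars (Fin n) k

/-- Minimality of the generators puts the kernel of the covering map into `𝔪` times the free module,
so the construction can be iterated. -/
theorem MinimalSyzygy.exists_next (A : MinimalSyzygy k n) :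
    ∃ (B : MinimalSyzygy k n) (φ : (Fin B.rank → MvPolynomial (Fin n) k)
        →ₗ[MvPolynomial (Fin n) k] (Fin A.rank → MvPolynomial (Fin n) k)),
      LinearMap.range φ = A.ker ∧ LinearMap.ker φ = B.ker ∧
        ∀ b, VectorHomogeneous A.deg (B.deg b) (φ (Pi.single b 1)) := by
  classical
  obtain ⟨m, d', b, hb, hmin⟩ := exists_minimal_homogeneousGenerators A.isGraded
  let φ := Fintype.linearCombination (MvPolynomial (Fin n) k) b
  have hφ : ∀ i, VectorHomogeneous A.deg (d' i) (φ (Pi.single i 1)) := fun i => by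
    rw [Fintype.linearCombination_apply_single, one_smul]
    exact hb.1 i
  refine ⟨⟨m, d', LinearMap.ker φ, fun x hx e => ?_, fun x hx c => ?_⟩, φ, ?_, rfl, hφ⟩
  · rw [LinearMap.mem_ker, ← vectorComponent_map A.deg d' e φ hφ, LinearMap.mem_ker.1 hx]
    funext c
    simp [vectorComponent]
  · exact hmin x hx c
  · rw [← hb.2]
    exact Fintype.range_linearCombination (MvPolynomial (Fin n) k) b

/-- Every homogeneous ideal contained in `𝔪` has a minimal graded free resolution. -/
theorem exists_isMinimal_gradedFreeResolution (I : Ideal (MvPolynomial (Fin n) k))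
    (hI : ∀ q ∈ I, ∀ e, homogeneousComponent e q ∈ I) (hm : I ≤ idealOfVars (Fin n) k) :
    ∃ F : GradedFreeResolution I, F.IsMinimal := by
  classical
  choose next φ hrange hker hφ using fun A : MinimalSyzygy k n => A.exists_next
  let A₀ : MinimalSyzygy k n :=
    { rank := 1
      deg := fun _ => 0
      ker := Submodule.comap (LinearMap.proj 0) I
      isGraded := fun x hx e => by
        simpa [vectorComponent, shiftedComponent] using hI _ hx e
      le := fun x hx c => by
        rw [Subsingleton.elim c 0]
        exact hm hx }
  let A : ℕ → MinimalSyzygy k n := fun i => Nat.rec A₀ (fun _ B => next B) i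
  refine ⟨
    { rank := fun i => (A i).rank
      deg := fun i => (A i).deg
      diff := fun i => φ (A i)
      aug := Submodule.mkQ I ∘ₗ LinearMap.proj (0 : Fin 1)
      diff_homogeneous := fun i b c => hφ (A i) b c
      aug_homogeneous := fun b => ⟨1, isHomogeneous_one _ _, ?_⟩
      exact_succ := fun i => LinearMap.exact_iff.2 ((hker (A i)).trans (hrange (A (i + 1))).symm)
      exact_zero := LinearMap.exact_iff.2 (Eq.trans ?_ (hrange A₀).symm)
      aug_surjective := ?_ }, fun i x c => ?_⟩
  · change Fin 1 at b
    rw [Subsingleton.elim b 0]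
    simp
  · rw [LinearMap.ker_comp, Submodule.ker_mkQ]
  · refine (Submodule.mkQ_surjective I).comp fun q => ⟨fun _ => q, rfl⟩
  · exact (A i).le _ (hrange (A i) ▸ LinearMap.mem_range_self (φ (A i)) x) c

theorem exists_isMinimal_gradedFreeResolution_monomialIdeal {r : ℕ} (u : Fin r → (Fin n →₀ ℕ))
    (hu : ∀ i, u i ≠ 0) :
    ∃ F : GradedFreeResolution (monomialIdeal k u), F.IsMinimal := by
  refine exists_isMinimal_gradedFreeResolution _ (fun q hq e => ?_) ?_
  · rw [mem_monomialIdeal] at hq ⊢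
    intro a ha
    rw [support_homogeneousComponent, Finset.mem_filter] at ha
    exact hq a ha.1
  · rw [monomialIdeal, Ideal.span_le]
    rintro _ ⟨i, rfl⟩
    exact mem_idealOfVars_iff.2 (by simp [constantCoeff_monomial, hu i])

end MinimalResolution

/-! ### Associated primes along regular sequences. -/

section AssociatedPrimes

open RingTheory.Sequence

/-- A prime inside `m` that is minimal over the annihilator of `x` is associated to the cyclic
module generated by `x`. -/
theorem exists_isAssociatedPrime_of_annihilator_le {R M : Type*} [CommRing R] [IsNoetherianRing R]
    [AddCommGroup M] [Module R M] {m : Ideal R} [m.IsPrime] (x : M)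
    (hx : (Submodule.span R {x}).annihilator ≤ m) :
    ∃ P : Ideal R, IsAssociatedPrime P M ∧ (Submodule.span R {x}).annihilator ≤ P ∧ P ≤ m := by
  obtain ⟨P, hP, hPm⟩ := Ideal.exists_minimalPrimes_le hx
  have hPass : IsAssociatedPrime P (Submodule.span R {x}) :=
    Module.associatedPrimes.minimalPrimes_annihilator_subset_associatedPrimes R (Submodule.span R {x}) hP
  exact ⟨P, hPass.map_of_injective (f := (Submodule.span R {x}).subtype)
    Subtype.val_injective, hP.1.2, hPm⟩

-- Let `N` be the submodule of `M` killed by `P`. It is supported at `m`, hence so is `N / fN`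
-- because `f ∈ m`. Regularity of `f` gives `N ∩ fM = fN`, so `N / fN` embeds in `M / fM`. A
-- suitable class there is killed by `P` and by `f`, while its annihilator stays inside `m`. The
-- inclusion is strict since `f`, being regular, is not in `P`.
open scoped Pointwise in
theorem exists_isAssociatedPrime_quotSMulTop {R M : Type*} [CommRing R] [IsNoetherianRing R]
    [AddCommGroup M] [Module R M] [Module.Finite R M] {m P : Ideal R} [m.IsPrime]
    (hP : IsAssociatedPrime P M) (hPm : P ≤ m) {f : R} (hfm : f ∈ m) (hf : IsSMulRegular M f) :
    ∃ Q : Ideal R, IsAssociatedPrime Q (QuotSMulTop f M) ∧ P < Q ∧ Q ≤ m := by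
  obtain ⟨hPprime, x, hx⟩ := isAssociatedPrime_iff.1 hP
  have hmemP : ∀ a, a ∈ P ↔ a • x = 0 := fun a => by
    rw [hx, Submodule.mem_colon_singleton, Submodule.mem_bot]
  let N := Submodule.torsionBySet R M P
  have hxN : x ∈ N := by
    rw [Submodule.mem_torsionBySet_iff]
    exact fun a => (hmemP a).1 a.2
  have hfin : Module.Finite R N := inferInstance
  have hsupp : (⟨m, inferInstance⟩ : PrimeSpectrum R) ∈ Module.support R N := by
    rw [Module.mem_support_iff_exists_annihilator]
    refine ⟨⟨x, hxN⟩, fun a ha => hPm ((hmemP a).2 ?_)⟩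
    rw [Submodule.mem_annihilator_span_singleton] at ha
    exact congrArg Subtype.val ha
  have hsupp' : (⟨m, inferInstance⟩ : PrimeSpectrum R) ∈
      Module.support R (N ⧸ (Ideal.span {f} • ⊤ : Submodule R N)) := by
    rw [Module.support_quotient]
    exact ⟨hsupp, by simpa [PrimeSpectrum.mem_zeroLocus] using hfm⟩
  obtain ⟨w, hw⟩ := Module.mem_support_iff_exists_annihilator.1 hsupp'
  obtain ⟨y, rfl⟩ := Submodule.mkQ_surjective _ w
  obtain ⟨Q, hQ, hle, hQm⟩ := exists_isAssociatedPrime_of_annihilator_le (m := m)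
    (Submodule.Quotient.mk (y : M) : QuotSMulTop f M) (fun a ha => hw (by
      rw [Submodule.mem_annihilator_span_singleton] at ha ⊢
      rw [← Submodule.Quotient.mk_smul, Submodule.Quotient.mk_eq_zero,
        Submodule.mem_smul_pointwise_iff_exists] at ha
      obtain ⟨z, -, hz⟩ := ha
      -- If `f z` is killed by `P`, so is `z`, by regularity of `f`.
      have hzN : z ∈ N := by
        rw [Submodule.mem_torsionBySet_iff]
        intro b
        refine hf ?_
        have hy := (Submodule.mem_torsionBySet_iff _ _).1 y.2 b
        change f • ((b : R) • z) = f • (0 : M)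
        change (b : R) • (y : M) = 0 at hy
        rw [smul_comm, hz, smul_comm, hy, smul_zero, smul_zero]
      rw [Submodule.mkQ_apply, ← Submodule.Quotient.mk_smul, Submodule.Quotient.mk_eq_zero]
      have : a • y = f • (⟨z, hzN⟩ : N) := Subtype.ext hz.symm
      rw [this]
      exact Submodule.smul_mem_smul (Ideal.mem_span_singleton_self f) trivial))
  refine ⟨Q, hQ, lt_of_le_of_ne (fun a ha => hle ?_) ?_, hQm⟩
  · rw [Submodule.mem_annihilator_span_singleton, ← Submodule.Quotient.mk_smul]
    have hy := (Submodule.mem_torsionBySet_iff _ _).1 y.2 ⟨a, ha⟩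
    change a • (y : M) = 0 at hy
    rw [hy, Submodule.Quotient.mk_zero]
  · rintro rfl
    have hfP : f ∈ P := hle (by
      rw [Submodule.mem_annihilator_span_singleton, ← Submodule.Quotient.mk_smul,
        Submodule.Quotient.mk_eq_zero]
      exact Submodule.smul_mem_pointwise_smul _ _ _ trivial)
    have hx0 : x = 0 := hf (by
      change f • x = f • (0 : M)
      rw [(hmemP f).1 hfP, smul_zero])
    exact hPprime.ne_top ((Ideal.eq_top_iff_one P).2 ((hmemP 1).2 (by rw [hx0, smul_zero])))

/-- The height of an associated prime inside `m`, plus the length of a regular sequence in `m`, is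
at most the height of `m`. -/
theorem height_add_length_le_of_isWeaklyRegular {R M : Type*} [CommRing R] [IsNoetherianRing R]
    [AddCommGroup M] [Module R M] [Module.Finite R M] {m P : Ideal R} [m.IsPrime]
    (hP : IsAssociatedPrime P M) (hPm : P ≤ m) (fs : List R) (hfs : ∀ f ∈ fs, f ∈ m)
    (hreg : IsWeaklyRegular M fs) : P.height + fs.length ≤ m.height := by
  induction fs generalizing M P with
  | nil => simpa using Ideal.height_mono hPm
  | cons f fs ih =>
    rw [isWeaklyRegular_cons_iff] at hreg
    obtain ⟨Q, hQ, hPQ, hQm⟩ := exists_isAssociatedPrime_quotSMulTop hP hPm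
      (hfs f List.mem_cons_self) hreg.1
    have h := ih hQ hQm (fun g hg => hfs g (List.mem_cons_of_mem f hg)) hreg.2
    have hPp := hP.isPrime
    have hQp := hQ.isPrime
    have hlt := Order.add_one_le_of_lt (Ideal.height_strict_mono_of_isPrime_of_isPrime hPQ)
    refine le_trans ?_ h
    rw [List.length_cons, Nat.cast_add, Nat.cast_one, add_comm (fs.length : ℕ∞), ← add_assoc]
    gcongr

end AssociatedPrimes

/-! ### Heights of ideals generated by variables. -/

section Variables

variable {k : Type*} [Field k] {n : ℕ}

theorem isPrime_idealOfVars : (idealOfVars (Fin n) k).IsPrime := by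
  have : idealOfVars (Fin n) k = RingHom.ker (constantCoeff (R := k) (σ := Fin n)) := by
    ext q
    rw [mem_idealOfVars_iff, RingHom.mem_ker]
  rw [this]
  exact RingHom.ker_isPrime _

theorem isPrime_span_X_image (A : Finset (Fin n)) :
    (Ideal.span ((X : Fin n → MvPolynomial (Fin n) k) '' A)).IsPrime := by
  classical
  let J := Ideal.span ((X : Fin n → MvPolynomial (Fin n) k) '' A)
  let θ : MvPolynomial (Fin n) k →ₐ[k] MvPolynomial (Fin n) k :=
    aeval fun i => if i ∈ A then 0 else X i
  -- Setting the variables of `A` to zero changes nothing modulo `J`, so the kernel of `θ` is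
  -- contained in `J`.
  have hmk : (Ideal.Quotient.mkₐ k J).comp θ = Ideal.Quotient.mkₐ k J := by
    refine MvPolynomial.algHom_ext fun i => ?_
    simp only [AlgHom.comp_apply, θ, aeval_X]
    split_ifs with hi
    · have hX : (X i : MvPolynomial (Fin n) k) ∈ J := Ideal.subset_span ⟨i, hi, rfl⟩
      rw [map_zero]
      exact (Ideal.Quotient.eq_zero_iff_mem.2 hX).symm
    · rfl
  have : J = RingHom.ker θ.toRingHom := by
    refine le_antisymm (Ideal.span_le.2 ?_) fun q hq => ?_
    · rintro _ ⟨i, hi, rfl⟩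
      have hi' : i ∈ A := hi
      simp [θ, RingHom.mem_ker, hi']
    · have h := DFunLike.congr_fun hmk q
      have hq' : θ q = 0 := hq
      rw [AlgHom.comp_apply, hq', map_zero] at h
      exact Ideal.Quotient.eq_zero_iff_mem.1 h.symm
  change J.IsPrime
  rw [this]
  exact RingHom.ker_isPrime _

/-- Adjoining the variables one at a time gives a strictly increasing chain of primes. -/
theorem card_le_height_span_X_image (A : Finset (Fin n)) :
    (A.card : ℕ∞) ≤ (Ideal.span ((X : Fin n → MvPolynomial (Fin n) k) '' A)).height := by
  classical
  induction A using Finset.induction_on with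
  | empty => simp
  | insert i A hi ih =>
    have h1 := isPrime_span_X_image (k := k) A
    have h2 := isPrime_span_X_image (k := k) (insert i A)
    have hlt : Ideal.span ((X : Fin n → MvPolynomial (Fin n) k) '' A) <
        Ideal.span ((X : Fin n → MvPolynomial (Fin n) k) '' (insert i A : Finset (Fin n))) := by
      refine lt_of_le_of_ne (Ideal.span_mono (Set.image_mono (by simp))) fun h => ?_
      have hX : (X i : MvPolynomial (Fin n) k) ∈
          Ideal.span ((X : Fin n → MvPolynomial (Fin n) k) '' A) := by
        rw [h]
        exact Ideal.subset_span ⟨i, by simp, rfl⟩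
      rw [mem_ideal_span_X_image] at hX
      obtain ⟨j, hj, hne⟩ := hX (Finsupp.single i 1) (by simp [X])
      rw [Finsupp.single_apply] at hne
      have : i = j := by
        by_contra hij
        exact hne (if_neg hij)
      exact hi (this ▸ hj)
    rw [Finset.card_insert_of_notMem hi, Nat.cast_add, Nat.cast_one]
    exact (add_le_add_left ih 1).trans
      (Order.add_one_le_of_lt (Ideal.height_strict_mono_of_isPrime_of_isPrime hlt))

theorem height_idealOfVars_le : (idealOfVars (Fin n) k).height ≤ n := by
  have := isPrime_idealOfVars (k := k) (n := n)
  have h := Ideal.height_le_ringKrullDim_of_isPrime (I := idealOfVars (Fin n) k)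
  rw [MvPolynomial.ringKrullDim_of_isNoetherianRing, ringKrullDim_eq_zero_of_field, zero_add,
    Nat.card_fin] at h
  exact_mod_cast h

end Variables

/-! ### The associated prime attached to a critical set, and the depth bound. -/

section Depth

variable {k : Type*} [Field k] {n r : ℕ} (u : Fin r → (Fin n →₀ ℕ))

/-- The minimality of a critical set gives each of its members a variable of its own. -/
theorem exists_private_variable {σ : Finset (Fin r)}
    (hσ : ∀ v ∈ σ, lcmExp u σ ≠ lcmExp u (σ.erase v)) :
    ∃ j : σ → Fin n, Function.Injective j ∧
      ∀ v : σ, lcmExp u (σ.erase v) (j v) < u v (j v) := by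
  have h : ∀ v : σ, ∃ j, lcmExp u (σ.erase v) j < u v j := by
    intro v
    by_contra! hcon
    exact hσ v v.2 (le_antisymm (lcmExp_insert_le u hcon le_rfl)
      (lcmExp_mono u (Finset.erase_subset _ _)))
  choose j hj using h
  have hj' : ∀ v w : σ, v ≠ w → u w (j v) < u v (j v) := fun v w hvw =>
    (le_lcmExp u (Finset.mem_erase.2 ⟨fun h => hvw (Subtype.ext h.symm), w.2⟩) (j v)).trans_lt
      (hj v)
  refine ⟨j, fun v w hvw => ?_, hj⟩
  by_contra hne
  have h1 := hj' v w hne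
  have h2 := hj' w v (Ne.symm hne)
  rw [hvw] at h1
  exact absurd h1 h2.not_gt

/-- The monomial `m_σ / ∏ x_j`, over the private variables, is not in the ideal but is multiplied
into it by each private variable. -/
theorem exists_socle_monomial {σ : Finset (Fin r)} (hσ : IsCritical u σ) :
    ∃ (A : Finset (Fin n)) (z : Fin n →₀ ℕ), A.card = σ.card ∧ (∀ v, ¬ u v ≤ z) ∧
      ∀ i ∈ A, ∃ v, u v ≤ z + Finsupp.single i 1 := by
  classical
  obtain ⟨j, hjinj, hj'⟩ := exists_private_variable u hσ.1
  have hj : ∀ v : σ, ∀ w ∈ σ, w ≠ v → u w (j v) < u v (j v) := fun v w hw hwv =>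
    (le_lcmExp u (Finset.mem_erase.2 ⟨hwv, hw⟩) (j v)).trans_lt (hj' v)
  let A := Finset.univ.image j
  let z : Fin n →₀ ℕ := lcmExp u σ - ∑ i ∈ A, Finsupp.single i 1
  have hsum : ∀ i, (∑ i ∈ A, Finsupp.single i 1 : Fin n →₀ ℕ) i = if i ∈ A then 1 else 0 := by
    intro i
    rw [Finsupp.finsetSum_apply]
    simp [Finsupp.single_apply]
  have hz : ∀ i, z i = lcmExp u σ i - if i ∈ A then 1 else 0 := fun i => by
    simp only [z, Finsupp.tsub_apply, hsum]
  have hmem : ∀ v, j v ∈ A := fun v => Finset.mem_image_of_mem _ (Finset.mem_univ v)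
  have hlcm : ∀ v : σ, lcmExp u σ (j v) = u v (j v) := by
    intro v
    refine le_antisymm ?_ (le_lcmExp u v.2 _)
    -- A common upper bound of the `u w` with `w ∈ σ`, equal to `u v` in the private variable of
    -- `v`.
    let b : Fin n →₀ ℕ := (lcmExp u σ).update (j v) (u v (j v))
    have : lcmExp u σ ≤ b := Finset.sup_le fun w hw i => by
      simp only [b, Finsupp.update_apply]
      split_ifs with hi
      · subst hi
        by_cases hwv : w = v
        · rw [hwv]
        · exact (hj v w hw hwv).le
      · exact le_lcmExp u hw i
    simpa [b] using this (j v)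
  have hpos : ∀ v : σ, 0 < lcmExp u σ (j v) := fun v =>
    (Nat.zero_le _).trans_lt ((hj' v).trans_le (le_lcmExp u v.2 _))
  refine ⟨A, z, ?_, fun v hv => ?_, fun i hi => ?_⟩
  · rw [Finset.card_image_of_injective _ hjinj]
    simp
  -- For `v ∈ σ`, the exponent of `z` in the private variable of `v` is one too small. For `v ∉ σ`,
  -- divisibility would give `u v ≤ m_σ`, against criticality.
  · by_cases hvσ : v ∈ σ
    · have h1 := hv (j ⟨v, hvσ⟩)
      rw [hz, if_pos (hmem _), hlcm] at h1
      have h2 := hpos ⟨v, hvσ⟩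
      rw [hlcm] at h2
      dsimp only at h1 h2
      omega
    · refine hσ.2 v hvσ (le_antisymm (lcmExp_mono u (Finset.subset_insert v σ)) ?_)
      refine lcmExp_insert_le u (v := v) (hv.trans tsub_le_self) ?_
      rw [Finset.erase_insert hvσ]
  -- The witness is the owner of the variable: in every other private variable `u v` lies strictly
  -- below `m_σ`, so lowering those exponents by one does no harm.
  · obtain ⟨v, -, rfl⟩ := Finset.mem_image.1 hi
    refine ⟨v, fun i => ?_⟩
    rw [Finsupp.add_apply, hz, Finsupp.single_apply]
    have h1 := le_lcmExp u v.2 i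
    by_cases hiA : i ∈ A
    · obtain ⟨w, -, rfl⟩ := Finset.mem_image.1 hiA
      by_cases hwv : j v = j w
      · rw [if_pos hwv]
        (split_ifs; omega)
      · have h2 := hj w v v.2 fun h => hwv (by rw [Subtype.ext h])
        have h3 := hlcm w
        (split_ifs; omega)
    · rw [if_neg hiA]
      omega

/-- The annihilator of the class of `x^z` contains the private variables, and it lies in `𝔪` because
`x^z` is not in the ideal. An associated prime lies in between. -/
theorem exists_isAssociatedPrime_card_le_height {σ : Finset (Fin r)} (hσ : IsCritical u σ) :
    ∃ P : Ideal (MvPolynomial (Fin n) k),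
      IsAssociatedPrime P (MvPolynomial (Fin n) k ⧸ monomialIdeal k u) ∧
        P ≤ idealOfVars (Fin n) k ∧ (σ.card : ℕ∞) ≤ P.height := by
  obtain ⟨A, z, hA, hz, hAz⟩ := exists_socle_monomial u hσ
  have := isPrime_idealOfVars (k := k) (n := n)
  have hann : ∀ q : MvPolynomial (Fin n) k, q ∈ (Submodule.span (MvPolynomial (Fin n) k)
      {(Ideal.Quotient.mk (monomialIdeal k u) (monomial z 1))}).annihilator ↔
      q * monomial z 1 ∈ monomialIdeal k u := by
    intro q
    rw [Submodule.mem_annihilator_span_singleton, ← Ideal.Quotient.eq_zero_iff_mem, map_mul]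
    rfl
  obtain ⟨P, hP, hle, hPm⟩ := exists_isAssociatedPrime_of_annihilator_le
    (m := idealOfVars (Fin n) k)
    (Ideal.Quotient.mk (monomialIdeal k u) (monomial z (1 : k))) (fun q hq => by
      rw [hann, mem_monomialIdeal] at hq
      rw [mem_idealOfVars_iff]
      by_contra hne
      obtain ⟨v, hv⟩ := hq z (by
        rw [mem_support_iff, coeff_mul_monomial', if_pos le_rfl, tsub_self, mul_one]
        exact hne)
      exact hz v hv)
  refine ⟨P, hP, hPm, hA ▸ (card_le_height_span_X_image (k := k) A).trans
    (Ideal.height_mono (Ideal.span_le.2 ?_))⟩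
  rintro _ ⟨i, hi, rfl⟩
  obtain ⟨v, hv⟩ := hAz i hi
  refine hle ((hann _).2 ((mem_monomialIdeal u).2 fun a ha => ⟨v, ?_⟩))
  rw [X, monomial_mul, mem_support_iff, coeff_monomial] at ha
  have : Finsupp.single i 1 + z = a := by
    by_contra h
    exact ha (if_neg h)
  rwa [← this, add_comm]

theorem depth_add_card_le {σ : Finset (Fin r)} (hσ : IsCritical u σ) :
    depth (monomialIdeal k u) + (σ.card : ℕ∞) ≤ n := by
  obtain ⟨P, hP, hPm, hcard⟩ := exists_isAssociatedPrime_card_le_height (k := k) u hσ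
  have := isPrime_idealOfVars (k := k) (n := n)
  have hn := height_idealOfVars_le (k := k) (n := n)
  have hle : (σ.card : ℕ∞) ≤ n := hcard.trans ((Ideal.height_mono hPm).trans hn)
  -- The supremum is bounded after moving `|σ|` across; `hle` ensures that the subtraction in `ℕ∞`
  -- is not truncated.
  refine add_le_of_le_tsub_right_of_le hle (sSup_le ?_)
  rintro _ ⟨fs, hfs, hreg, rfl⟩
  refine ENat.le_sub_of_add_le_right (ENat.natCast_ne_top _) ?_
  have h := height_add_length_le_of_isWeaklyRegular hP hPm fs hfs hreg.toIsWeaklyRegular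
  rw [add_comm]
  exact (add_le_add_left hcard _).trans (h.trans hn)

end Depth

/-- Existence of a minimal resolution excludes the default value `0`; the count then applies to
whichever resolution was chosen. -/
theorem gradedBetti_ne_zero_of_isCritical {k : Type*} [Field k] {n r : ℕ}
    (u : Fin r → (Fin n →₀ ℕ)) (hu : ∀ i, u i ≠ 0) {σ : Finset (Fin r)} (hσ : IsCritical u σ) :
    gradedBetti (monomialIdeal k u) σ.card (lcmExp u σ).degree ≠ 0 := by
  rw [gradedBetti, dif_pos (exists_isMinimal_gradedFreeResolution_monomialIdeal u hu)]
  exact GradedFreeResolution.count_ne_zero_of_isCritical u _ hσ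

end MonomialBetti

theorem mainTheorem2 {k : Type*} [Field k] {n r : ℕ} (u : Fin r → (Fin n →₀ ℕ))
    (hu : ∀ i, u i ≠ 0) :
    (∀ σ : Finset (Fin r), MonomialBetti.IsCritical u σ →
      MonomialBetti.gradedBetti (MonomialBetti.monomialIdeal k u) σ.card
        (MonomialBetti.lcmExp u σ).degree ≠ 0) ∧
    MonomialBetti.depth (MonomialBetti.monomialIdeal k u) +
        (MonomialBetti.pInvariant u : ℕ∞) ≤ (n : ℕ∞) ∧
    ((MonomialBetti.rInvariant u : ℤ) : WithBot (WithTop ℤ)) ≤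
      MonomialBetti.regularity (MonomialBetti.monomialIdeal k u) := by
  refine ⟨fun σ hσ => MonomialBetti.gradedBetti_ne_zero_of_isCritical u hu hσ, ?_, ?_⟩
  -- The maximum is attained, so the bound for a single critical set suffices.
  · obtain ⟨σ, hσ, h⟩ := (MonomialBetti.isGreatest_pInvariant u hu).1
    rw [h]
    exact MonomialBetti.depth_add_card_le u hσ
  · obtain ⟨σ, hσ, h⟩ := (MonomialBetti.isGreatest_rInvariant u hu).1
    rw [h]
    exact le_sSup ⟨_, _, MonomialBetti.gradedBetti_ne_zero_of_isCritical u hu hσ, rfl⟩
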